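/- Let $\mathbb{C}^*=\mathbb{C}\setminus\{0\}$ and let $f:\mathbb{C}^*\to\mathbb{C}^*$ be a holomorphic map for which both $0$ and $\infty$ are essential singularities. Let $\mathrm{sing}(f^{-1})\subseteq\mathbb{C}^*$ be the set of singular values of $f$, that is, the critical values $f(c)$ with $c\in\mathbb{C}^*$, $f'(c)=0$, together with the finite asymptotic values: the points $a\in\mathbb{C}^*$ for which there is a continuous injective curve $\gamma:(0,\infty)\to\mathbb{C}^*$ such that, as $t\to+\infty$, $\gamma(t)$ tends to $0$ or to $\infty$ and $f(\gamma(t))\to a$. Suppose that $\mathrm{sing}(f^{-1})$ is bounded away from $0$ and $\infty$, i.e. that there are $0<r$ and $R<\infty$ with $r\le |v|\le R$ for all $v\in \mathrm{sing}(f^{-1})$ (the class $\mathcal{B}^*$). Let $$I(f)=\Bigl\{z\in\mathbb{C}^* : \bigcap_{n\in\mathbb{N}}\overline{\{f^k(z):k\ge n\}}\subseteq\{0,\infty\}\Bigr\}$$ be the escaping set, where the closures are taken in the Riemann sphere $\hat{\mathbb{C}}$. Let $F(f)$ be the Fatou set, i.e. the set of $z\in\mathbb{C}^*$ having an open neighbourhood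 $U\subseteq\mathbb{C}^*$ on which the iterates $(f^n)_{n\in\mathbb{N}}$ form a normal family (every sequence of iterates has a subsequence converging locally uniformly on $U$ in the spherical metric to a function with values in $\hat{\mathbb{C}}$), and let $J(f)=\mathbb{C}^*\setminus F(f)$ be the Julia set. Then $I(f)\subseteq J(f)$. -/

import Mathlib

open Filter Topology Set

/-- The punctured plane `ℂ* = ℂ ∖ {0}`. -/
def puncturedPlane : Set ℂ := {z | z ≠ 0}

/-- The Riemann sphere `ℂ ∪ {∞}` is the one-point compactification `OnePoint ℂ`. Being compact and
Hausdorff it carries exactly one compatible uniform structure, which is therefore the one of the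
spherical (chordal) metric. -/
@[reducible] noncomputable def riemannSphereUniformSpace : UniformSpace (OnePoint ℂ) :=
  uniformSpaceOfCompactR1

/-- `a` is an isolated essential singularity of `f`: `f` is holomorphic on a punctured neighbourhood
of `a`, and the singularity is neither removable nor a pole. -/
def HasEssentialSingularityAt (f : ℂ → ℂ) (a : ℂ) : Prop :=
  (∀ᶠ z in 𝓝[≠] a, DifferentiableAt ℂ f z) ∧ ¬ MeromorphicAt f a

/-- `∞` is an isolated essential singularity of `f`. -/
def HasEssentialSingularityAtInfty (f : ℂ → ℂ) : Prop :=
  HasEssentialSingularityAt (fun z => f z⁻¹) 0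

/-- Transcendental self-maps of `ℂ*`: holomorphic maps `ℂ* → ℂ*` for which both `0` and `∞` are
essential singularities. The value `f 0` is irrelevant. -/
structure IsTranscendentalSelfMap (f : ℂ → ℂ) : Prop where
  differentiableOn : DifferentiableOn ℂ f puncturedPlane
  mapsTo : MapsTo f puncturedPlane puncturedPlane
  essential_zero : HasEssentialSingularityAt f 0
  essential_infty : HasEssentialSingularityAtInfty f

/-- The set of critical values `f c`, where `c ∈ ℂ*` and `f' c = 0`. -/
def criticalValues (f : ℂ → ℂ) : Set ℂ :=
  f '' {c | c ∈ puncturedPlane ∧ deriv f c = 0}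

/-- `γ : (0, ∞) → ℂ*` is a continuous injective curve that tends to `0` or to `∞`, along which `f`
tends to `a`. -/
structure IsAsymptoticPath (f : ℂ → ℂ) (a : ℂ) (γ : ℝ → ℂ) : Prop where
  continuousOn : ContinuousOn γ (Ioi 0)
  injOn : InjOn γ (Ioi 0)
  mapsTo : MapsTo γ (Ioi 0) puncturedPlane
  tendsto_essential : Tendsto γ atTop (𝓝 0) ∨ Tendsto γ atTop (cocompact ℂ)
  tendsto_value : Tendsto (fun t => f (γ t)) atTop (𝓝 a)

/-- The set of finite asymptotic values, that is, those different from `0` and `∞`. -/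
def asymptoticValues (f : ℂ → ℂ) : Set ℂ :=
  {a | a ∈ puncturedPlane ∧ ∃ γ : ℝ → ℂ, IsAsymptoticPath f a γ}

/-- The set `sing(f⁻¹)` of singular values: critical values and finite asymptotic values. -/
def singularValues (f : ℂ → ℂ) : Set ℂ :=
  criticalValues f ∪ asymptoticValues f

/-- The class `𝓑*` of bounded-type transcendental self-maps of `ℂ*`: the singular values are
bounded away from `0` and `∞`. -/
structure IsBoundedType (f : ℂ → ℂ) : Prop where
  transcendental : IsTranscendentalSelfMap f
  bounded : ∃ r R : ℝ, 0 < r ∧ singularValues f ⊆ {z | r ≤ ‖z‖ ∧ ‖z‖ ≤ R}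

/-- The omega-limit set of `z` under `f`, with the closure taken in the Riemann sphere. -/
def omegaLimitSet (f : ℂ → ℂ) (z : ℂ) : Set (OnePoint ℂ) :=
  ⋂ n : ℕ, closure {w : OnePoint ℂ | ∃ k : ℕ, n ≤ k ∧ w = ((f^[k] z : ℂ) : OnePoint ℂ)}

/-- The escaping set of a self-map of `ℂ*`. -/
def escapingSet (f : ℂ → ℂ) : Set ℂ :=
  {z | z ∈ puncturedPlane ∧
    omegaLimitSet f z ⊆ {((0 : ℂ) : OnePoint ℂ), OnePoint.infty}}

/-- A family of functions is normal on `U` if every sequence of its members has a subsequence that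
converges locally uniformly on `U` with respect to the spherical metric, to a function with values
in the Riemann sphere. -/
def IsNormalFamilyOn {ι : Type*} (F : ι → ℂ → ℂ) (U : Set ℂ) : Prop :=
  letI := riemannSphereUniformSpace
  ∀ s : ℕ → ι, ∃ φ : ℕ → ℕ, StrictMono φ ∧ ∃ g : ℂ → OnePoint ℂ,
    TendstoLocallyUniformlyOn (fun k z => ((F (s (φ k)) z : ℂ) : OnePoint ℂ)) g atTop U

/-- The Fatou set of a self-map of `ℂ*`. -/
def fatouSet (f : ℂ → ℂ) : Set ℂ :=
  {z | ∃ U : Set ℂ, IsOpen U ∧ z ∈ U ∧ U ⊆ puncturedPlane ∧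
    IsNormalFamilyOn (fun n : ℕ => f^[n]) U}

/-- The Julia set of a self-map of `ℂ*`: the complement of the Fatou set in `ℂ*`. -/
def juliaSet (f : ℂ → ℂ) : Set ℂ :=
  puncturedPlane \ fatouSet f

/-!
# The escaping set of a bounded-type self-map of `ℂ*` lies in its Julia set

In logarithmic coordinates `f` expands wherever `f z` is close to `0` or `∞`, whereas around an
escaping point of the Fatou set the logarithms of the iterates cannot have images containing large
discs.

Two facts drive the argument.

* Since `0` and `∞` are essential singularities of the zero-free function `f`, the maximum principle
  shows that `|f|` takes values both below and above `1` on every circle `|z| = t` with `t` close to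
  `0` or `∞`, so each such circle contains a point with `|f| = 1`. Consequently there is a
  radius `Q = K + 5` such that every disc of radius `Q`, whatever its centre, contains a point `x`
  with `|f (exp x)| = 1` (`exists_mem_ball_norm_exp_eq_one`).
* A holomorphic function on a disc of radius `ρ` about `a` has an image containing a disc of radius
  `ρ |g' a| / 96` (`exists_ball_subset_image_of_deriv_ne_zero`, a form of Bloch's theorem).

*Expansion* (`two_le_norm_logDeriv`). Let `|log |v|| ≤ Λ` for all singular values `v`. If
`|log |f u|| > Λ + M`, then the disc of radius `M` about `log (f u)` is mapped by `exp` into a region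
free of singular values, and `f` has an inverse branch over it: there is a holomorphic `l` on this
disc with `f (exp (l w)) = exp w`, starting at a logarithm of `u`. Its image contains no `x` with
`|f (exp x)| = 1`, hence no disc of radius `Q`, so Bloch's theorem bounds `|l'|` at the centre by
`96 Q / M = 1 / 2` for `M = 192 Q`. Therefore `|u f'(u) / f u| ≥ 2`. The branch is
obtained by lifting radial segments; a segment whose lift breaks off would yield an asymptotic value
(`exists_lift_exp_segment`, `exists_inverse_branch`).

*Conclusion.* If `z` is an escaping point in the Fatou set, normality gives a disc about `z` on
which all late iterates satisfy `|log |f^n|| > Λ + M`, see `exists_ball_iterates_large`. After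
replacing `z` by some `f^N z` this holds for all `n`. By expansion the logarithms `l_n` of `f^n`
have derivatives growing like `2 ^ n` at the centre, so for large `n` the image of `l_n` contains a
disc of radius `Q`, hence a point `x` with `|f (exp x)| = 1`. This means that `|f^(n+1)| = 1`
somewhere on the disc, a contradiction.
-/

open Metric

/-! ### A form of Bloch's theorem -/

/-- A weak form of **Bloch's theorem**. Landau's argument: at a point `b` where
`(ρ / 2 - |z - a|) |g' z|` is maximal, `|g'|` is at most `2 |g' b|` on a disc about `b`, and there
`g` is close to its linear part. -/
theorem exists_ball_subset_image_of_deriv_ne_zero {g : ℂ → ℂ} {a : ℂ} {ρ : ℝ} (hρ : 0 < ρ)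
    (hg : DifferentiableOn ℂ g (ball a ρ)) (ha : deriv g a ≠ 0) :
    ∃ c, ball c (ρ * ‖deriv g a‖ / 96) ⊆ g '' ball a ρ := by
  have hg' : DifferentiableOn ℂ (deriv g) (ball a ρ) := hg.deriv isOpen_ball
  have hsub : closedBall a (ρ / 2) ⊆ ball a ρ := closedBall_subset_ball (by linarith)
  have hA0 : 0 < ‖deriv g a‖ := norm_pos_iff.mpr ha
  obtain ⟨b, hb, hmax⟩ := (isCompact_closedBall a (ρ / 2)).exists_isMaxOn
    (f := fun z => (ρ / 2 - dist z a) * ‖deriv g z‖) ⟨a, mem_closedBall_self (by positivity)⟩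
    ((by fun_prop : Continuous fun z => ρ / 2 - dist z a).continuousOn.mul
      (hg'.continuousOn.mono hsub).norm)
  have hφa : ρ / 2 * ‖deriv g a‖ ≤ (ρ / 2 - dist b a) * ‖deriv g b‖ := by
    simpa using hmax (mem_closedBall_self (by positivity : (0 : ℝ) ≤ ρ / 2))
  have hφpos : 0 < (ρ / 2 - dist b a) * ‖deriv g b‖ := lt_of_lt_of_le (by positivity) hφa
  have hs2 : 0 < ρ / 2 - dist b a := pos_of_mul_pos_left hφpos (norm_nonneg _)
  set A := ‖deriv g b‖ with hA
  have hApos : 0 < A := pos_of_mul_pos_right hφpos hs2.le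
  obtain ⟨s, hs⟩ : ∃ s, s = (ρ / 2 - dist b a) / 2 := ⟨_, rfl⟩
  have hspos : 0 < s := by rw [hs]; positivity
  have hball : ball b s ⊆ closedBall a (ρ / 2) := fun z hz => by
    have := dist_triangle z b a
    rw [mem_ball] at hz
    rw [mem_closedBall]; linarith
  have hbound : ∀ z ∈ ball b s, ‖deriv g z‖ ≤ 2 * A := fun z hz => by
    have h1 : (ρ / 2 - dist z a) * ‖deriv g z‖ ≤ (ρ / 2 - dist b a) * A := hmax (hball hz)
    have h2 : s ≤ ρ / 2 - dist z a := by
      have := dist_triangle z b a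
      rw [mem_ball] at hz
      linarith
    have h3 : s * ‖deriv g z‖ ≤ s * (2 * A) := by
      calc s * ‖deriv g z‖ ≤ (ρ / 2 - dist z a) * ‖deriv g z‖ := by gcongr
        _ ≤ (ρ / 2 - dist b a) * A := h1
        _ = s * (2 * A) := by rw [hs]; ring
    exact le_of_mul_le_mul_left h3 hspos
  have hmaps : MapsTo (deriv g) (ball b s) (closedBall (deriv g b) (3 * A)) := fun z hz => by
    rw [mem_closedBall, dist_eq_norm]
    have := norm_sub_le (deriv g z) (deriv g b)
    have := hbound z hz
    linarith
  -- The Schwarz lemma for `g'` shows that `g'` differs from `g' b` by at most `A / 2` on the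
  -- disc of radius `s / 6`.
  have hsmall : closedBall b (s / 6) ⊆ ball b s := closedBall_subset_ball (by linarith)
  have hclose : ∀ z ∈ closedBall b (s / 6), ‖deriv g z - deriv g b‖ ≤ A / 2 := fun z hz => by
    have h1 := Complex.dist_le_div_mul_dist_of_mapsTo_ball
      (hg'.mono (hball.trans hsub)) hmaps (hsmall hz)
    rw [dist_eq_norm] at h1
    rw [mem_closedBall] at hz
    calc _ ≤ 3 * A / s * dist z b := h1
      _ ≤ 3 * A / s * (s / 6) := by gcongr
      _ = A / 2 := by field_simp; norm_num
  have hdiff : ∀ z ∈ closedBall b (s / 6), DifferentiableAt ℂ g z := fun z hz =>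
    hg.differentiableAt (isOpen_ball.mem_nhds (hsub (hball (hsmall hz))))
  have hlin : ∀ z ∈ closedBall b (s / 6),
      ‖(g z - deriv g b * z) - (g b - deriv g b * b)‖ ≤ A / 2 * ‖z - b‖ := fun z hz => by
    refine (convex_closedBall b (s / 6)).norm_image_sub_le_of_norm_hasDerivWithin_le
      (f := fun z => g z - deriv g b * z) (f' := fun z => deriv g z - deriv g b)
      (fun x hx => ?_) hclose (mem_closedBall_self (by positivity)) hz
    have := ((hdiff x hx).hasDerivAt.fun_sub
      ((hasDerivAt_id' x).const_mul (deriv g b))).hasDerivWithinAt (s := closedBall b (s / 6))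
    rwa [mul_one] at this
  have hsphere : ∀ z ∈ sphere b (s / 6), A * s / 12 ≤ ‖g z - g b‖ := fun z hz => by
    have h1 := hlin z (sphere_subset_closedBall hz)
    have hz' : ‖z - b‖ = s / 6 := by rwa [mem_sphere, dist_eq_norm] at hz
    have h2 : ‖deriv g b * (z - b)‖ = A * (s / 6) := by rw [norm_mul, hz']
    have h3 := norm_sub_norm_le (deriv g b * (z - b)) (g b - g z + deriv g b * (z - b))
    have h4 : deriv g b * (z - b) - (g b - g z + deriv g b * (z - b)) = g z - g b := by ring
    have h5 : ‖g b - g z + deriv g b * (z - b)‖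
        = ‖(g z - deriv g b * z) - (g b - deriv g b * b)‖ := by
      rw [← norm_neg]; congr 1; ring
    rw [h4, h5, h2] at h3
    rw [hz'] at h1
    linarith
  have hb' : b ∈ ball a ρ := hsub hb
  have hfreq : ∃ᶠ z in 𝓝 b, g z ≠ g b := by
    intro hconst
    have h1 : g =ᶠ[𝓝 b] fun _ => g b := by
      filter_upwards [hconst] with z hz using not_not.mp hz
    have h2 : deriv g b = 0 := by rw [h1.deriv_eq, deriv_const]
    rw [hA, h2, norm_zero] at hApos
    exact hApos.false
  have hdc : DiffContOnCl ℂ g (ball b (s / 6)) :=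
    DifferentiableOn.diffContOnCl fun z hz => by
      rw [closure_ball b (by positivity)] at hz
      exact (hdiff z hz).differentiableWithinAt
  have hfin := hdc.ball_subset_image_closedBall (by positivity) hsphere hfreq
  refine ⟨g b, (ball_subset_ball ?_).trans (hfin.trans
    (image_mono ((hsmall.trans hball).trans hsub)))⟩
  have : ρ / 2 * ‖deriv g a‖ ≤ 2 * s * A := by rw [hs]; linarith
  linarith

/-! ### Logarithms of holomorphic functions on discs -/

theorem exists_differentiableOn_exp_eq {h : ℂ → ℂ} {a : ℂ} {ρ : ℝ}
    (hd : DifferentiableOn ℂ h (ball a ρ)) (hne : ∀ z ∈ ball a ρ, h z ≠ 0) :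
    ∃ l : ℂ → ℂ, DifferentiableOn ℂ l (ball a ρ) ∧ ∀ z ∈ ball a ρ, Complex.exp (l z) = h z := by
  rcases le_or_gt ρ 0 with hρ | hρ
  · refine ⟨0, ?_, ?_⟩ <;> simp [ball_eq_empty.mpr hρ]
  obtain ⟨l, hla, hl⟩ := (((hd.deriv isOpen_ball).div hd hne).isExactOn_ball).with_val_at a
    (Complex.log (h a))
  refine ⟨l, fun z hz => (hl z hz).differentiableAt.differentiableWithinAt, fun z hz => ?_⟩
  have hderiv : ∀ w ∈ ball a ρ, HasDerivAt (fun w => Complex.exp (l w) / h w) 0 w := by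
    intro w hw
    have h1 := ((hl w hw).cexp).div
      (hd.differentiableAt (isOpen_ball.mem_nhds hw)).hasDerivAt (hne w hw)
    refine h1.congr_deriv ?_
    have := hne w hw
    simp only [Pi.div_apply]
    field_simp
    simp
  have hconst := isOpen_ball.is_const_of_deriv_eq_zero (convex_ball a ρ).isPreconnected
    (fun w hw => (hderiv w hw).differentiableAt.differentiableWithinAt)
    (fun w hw => (hderiv w hw).deriv) hz (mem_ball_self hρ)
  have ha := hne a (mem_ball_self hρ)
  simp only [hla, Complex.exp_log ha, div_self ha] at hconst
  exact (div_eq_one_iff_eq (hne z hz)).mp hconst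

/-! ### Circles near an essential singularity -/

theorem isOpen_puncturedPlane : IsOpen puncturedPlane := isOpen_ne

/-- If `|h| ≤ 1` on arbitrarily small circles, the maximum principle on the annuli between them
bounds `h` near `0`, so that the singularity is removable. -/
theorem eventually_exists_one_lt_norm_on_circle {h : ℂ → ℂ}
    (hd : DifferentiableOn ℂ h puncturedPlane) (hm : ¬ MeromorphicAt h 0) :
    ∀ᶠ t : ℝ in 𝓝[>] 0, ∃ z, ‖z‖ = t ∧ 1 < ‖h z‖ := by
  by_contra hcon
  have hfreq : ∃ᶠ t : ℝ in 𝓝[>] 0, ∀ z, ‖z‖ = t → ‖h z‖ ≤ 1 :=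
    (not_eventually.mp hcon).mono fun t ht z hz => by
      by_contra hlt
      exact ht ⟨z, hz, not_le.mp hlt⟩
  have hsmall : ∀ ε : ℝ, 0 < ε → ∃ t, 0 < t ∧ t < ε ∧ ∀ z, ‖z‖ = t → ‖h z‖ ≤ 1 := fun ε hε => by
    obtain ⟨t, ht, ht'⟩ := (hfreq.and_eventually (Ioo_mem_nhdsGT hε)).exists
    exact ⟨t, ht'.1, ht'.2, ht⟩
  obtain ⟨T, hT, -, hTb⟩ := hsmall 1 one_pos
  have hbound : ∀ z ∈ ball (0 : ℂ) T \ {0}, ‖h z‖ ≤ 1 := by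
    rintro z ⟨hzT, hz0⟩
    have hzpos : 0 < ‖z‖ := norm_pos_iff.mpr hz0
    obtain ⟨t, ht, htz, htb⟩ := hsmall ‖z‖ hzpos
    have hcl : closure (ball (0 : ℂ) T \ closedBall 0 t) ⊆ {w | t ≤ ‖w‖ ∧ ‖w‖ ≤ T} :=
      closure_minimal (fun w hw => by
        simp only [Set.mem_sdiff, mem_ball, mem_closedBall, dist_zero_right, not_le] at hw
        exact ⟨hw.2.le, hw.1.le⟩)
        ((isClosed_le continuous_const continuous_norm).inter
          (isClosed_le continuous_norm continuous_const))
    have hopen : IsOpen (ball (0 : ℂ) T \ closedBall 0 t) := isOpen_ball.sdiff isClosed_closedBall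
    refine Complex.norm_le_of_forall_mem_frontier_norm_le
      (U := ball (0 : ℂ) T \ closedBall 0 t) (isBounded_ball.subset sdiff_subset)
      (DifferentiableOn.diffContOnCl (hd.mono fun w hw => ?_)) (fun w hw => ?_) (subset_closure ?_)
    · exact norm_pos_iff.mp (ht.trans_le (hcl hw).1)
    · rw [hopen.frontier_eq] at hw
      obtain ⟨h1, h2⟩ := hcl hw.1
      rcases h1.eq_or_lt with h1 | h1
      · exact htb w h1.symm
      rcases h2.eq_or_lt with h2 | h2
      · exact hTb w h2
      · exact absurd (by simp [h1, h2]) hw.2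
    · simpa [htz] using hzT
  have hupd := Complex.differentiableOn_update_limUnder_of_bddAbove (ball_mem_nhds (0 : ℂ) hT)
    (hd.mono fun z hz => hz.2)
    ⟨1, by rintro _ ⟨z, hz, rfl⟩; exact hbound z hz⟩
  have hmer := (hupd.analyticAt (ball_mem_nhds (0 : ℂ) hT)).meromorphicAt
  refine hm (hmer.congr ?_)
  filter_upwards [self_mem_nhdsWithin] with z hz
  exact Function.update_of_ne hz _ _

theorem eventually_exists_norm_eq_one_on_circle {h : ℂ → ℂ}
    (hd : DifferentiableOn ℂ h puncturedPlane) (hne : MapsTo h puncturedPlane puncturedPlane)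
    (hm : ¬ MeromorphicAt h 0) :
    ∀ᶠ t : ℝ in 𝓝[>] 0, ∃ z, ‖z‖ = t ∧ ‖h z‖ = 1 := by
  have hinv := eventually_exists_one_lt_norm_on_circle (h := h⁻¹) (hd.inv hne)
    (fun H => hm (by simpa using H.inv))
  filter_upwards [eventually_exists_one_lt_norm_on_circle hd hm, hinv, self_mem_nhdsWithin]
    with t ⟨z, hz, hz1⟩ ⟨w, hw, hw1⟩ ht
  have hcont : ContinuousOn (fun z => ‖h z‖) (sphere 0 t) :=
    (hd.continuousOn.mono fun z hz => norm_pos_iff.mp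
      (by rw [mem_sphere_zero_iff_norm.mp hz]; exact ht)).norm
  have hw0 : ‖h w‖ ≤ 1 := by
    rw [Pi.inv_apply, norm_inv] at hw1
    by_contra hcon
    exact absurd hw1 (not_lt.mpr (inv_le_one_of_one_le₀ (not_le.mp hcon).le))
  obtain ⟨p, hp, hp1⟩ := (isPreconnected_sphere (by simp [Complex.rank_real_complex]) (0 : ℂ)
    t).intermediate_value (mem_sphere_zero_iff_norm.mpr hw) (mem_sphere_zero_iff_norm.mpr hz) hcont
    ⟨hw0, hz1.le⟩
  exact ⟨p, mem_sphere_zero_iff_norm.mp hp, hp1⟩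

theorem IsTranscendentalSelfMap.exists_norm_eq_one_on_circles {f : ℂ → ℂ}
    (hf : IsTranscendentalSelfMap f) :
    ∃ K : ℝ, 0 ≤ K ∧ ∀ t : ℝ, 0 < t → K < |Real.log t| → ∃ p, ‖p‖ = t ∧ ‖f p‖ = 1 := by
  have h0 := eventually_exists_norm_eq_one_on_circle hf.differentiableOn hf.mapsTo
    hf.essential_zero.2
  have hinvmaps : MapsTo (fun z : ℂ => z⁻¹) puncturedPlane puncturedPlane :=
    fun z hz => inv_ne_zero hz
  have h1 := eventually_exists_norm_eq_one_on_circle (h := fun z => f z⁻¹)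
    (hf.differentiableOn.comp (differentiableOn_inv) hinvmaps)
    (hf.mapsTo.comp hinvmaps) hf.essential_infty.2
  obtain ⟨δ, hδ, hsub⟩ := mem_nhdsGT_iff_exists_Ioo_subset.mp (h0.and h1)
  refine ⟨|Real.log δ|, abs_nonneg _, fun t ht hlog => ?_⟩
  have key : ∀ s : ℝ, 0 < s → Real.log s < -|Real.log δ| → s ∈ Ioo 0 δ := fun s hs hsl =>
    ⟨hs, (Real.log_lt_log_iff hs hδ).mp (hsl.trans_le (neg_abs_le _))⟩
  rcases lt_abs.mp hlog with h | h
  · obtain ⟨z, hz, hz1⟩ := (hsub (key t⁻¹ (by positivity) (by rw [Real.log_inv]; linarith))).2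
    exact ⟨z⁻¹, by rw [norm_inv, hz, inv_inv], hz1⟩
  · exact (hsub (key t ht (by linarith))).1

/-- The disc of radius `r` about `c` meets the vertical line of logarithms of `p` in a segment of
length more than `2 π`. -/
theorem exists_mem_ball_exp_eq {c p : ℂ} {r : ℝ} (hp : p ≠ 0)
    (hr : |Real.log ‖p‖ - c.re| + 4 ≤ r) : ∃ x ∈ ball c r, Complex.exp x = p := by
  refine ⟨Complex.log (p * Complex.exp (-(c.im * Complex.I))) + c.im * Complex.I, ?_, ?_⟩
  · rw [mem_ball, dist_eq_norm]
    refine (Complex.norm_le_abs_re_add_abs_im _).trans_lt ?_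
    have h1 : ‖Complex.exp (-(c.im * Complex.I))‖ = 1 := by simp [Complex.norm_exp]
    have h2 := Complex.abs_arg_le_pi (p * Complex.exp (-(c.im * Complex.I)))
    have h3 := Real.pi_lt_four
    simp only [Complex.sub_re, Complex.add_re, Complex.log_re, norm_mul, h1, mul_one,
      Complex.sub_im, Complex.add_im, Complex.log_im, Complex.mul_re, Complex.ofReal_re,
      Complex.I_re, mul_zero, Complex.ofReal_im, Complex.I_im, sub_self, add_zero,
      Complex.mul_im, add_sub_cancel_right]
    linarith
  · rw [Complex.exp_add, Complex.exp_log (mul_ne_zero hp (Complex.exp_ne_zero _)), mul_assoc,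
      ← Complex.exp_add]
    simp

/-- The disc may be centred near the imaginary axis, where nothing is known about the circles; the
radius `K + 5` leaves room to reach a vertical line with real part beyond `K`. -/
theorem exists_mem_ball_norm_exp_eq_one {f : ℂ → ℂ} {K : ℝ} (hK : 0 ≤ K)
    (hcirc : ∀ t : ℝ, 0 < t → K < |Real.log t| → ∃ p, ‖p‖ = t ∧ ‖f p‖ = 1) (c : ℂ) :
    ∃ x ∈ ball c (K + 5), ‖f (Complex.exp x)‖ = 1 := by
  obtain ⟨s, hs, hsc⟩ : ∃ s : ℝ, K < |s| ∧ |s - c.re| ≤ K + 1 := by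
    rcases le_or_gt 0 c.re with h | h
    · refine ⟨c.re + (K + 1), lt_abs.mpr (Or.inl (by linarith)), ?_⟩
      rw [add_sub_cancel_left, abs_of_nonneg (by linarith)]
    · refine ⟨c.re - (K + 1), lt_abs.mpr (Or.inr (by linarith)), ?_⟩
      rw [sub_sub_cancel_left, abs_neg, abs_of_nonneg (by linarith)]
  obtain ⟨p, hp, hp1⟩ := hcirc (Real.exp s) (Real.exp_pos s) (by rwa [Real.log_exp])
  obtain ⟨x, hx, rfl⟩ := exists_mem_ball_exp_eq (c := c) (p := p) (r := K + 5)
    (norm_pos_iff.mp (hp ▸ Real.exp_pos s)) (by rw [hp, Real.log_exp]; linarith)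
  exact ⟨x, hx, hp1⟩

/-! ### Iterates near an escaping point of the Fatou set -/

namespace IsTranscendentalSelfMap
variable {f : ℂ → ℂ}

theorem mapsTo_iterate (hf : IsTranscendentalSelfMap f) (n : ℕ) :
    MapsTo f^[n] puncturedPlane puncturedPlane :=
  hf.mapsTo.iterate n

theorem differentiableOn_iterate (hf : IsTranscendentalSelfMap f) (n : ℕ) :
    DifferentiableOn ℂ f^[n] puncturedPlane :=
  hf.differentiableOn.iterate hf.mapsTo n

theorem nhds_le_map_nhds (hf : IsTranscendentalSelfMap f) {z : ℂ} (hz : z ∈ puncturedPlane) :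
    𝓝 (f z) ≤ map f (𝓝 z) := by
  have han : AnalyticOnNhd ℂ f puncturedPlane :=
    hf.differentiableOn.analyticOnNhd isOpen_puncturedPlane
  refine (han z hz).eventually_constant_or_nhds_le_map_nhds.resolve_left fun hconst => ?_
  have hpre : IsPreconnected puncturedPlane :=
    (isConnected_compl_singleton_of_one_lt_rank (by simp [Complex.rank_real_complex])
      (0 : ℂ)).isPreconnected
  have heq := han.eqOn_of_preconnected_of_eventuallyEq analyticOnNhd_const hpre hz hconst
  refine hf.essential_zero.2 ((MeromorphicAt.const (f z) 0).congr ?_)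
  filter_upwards [self_mem_nhdsWithin] with w hw using (heq hw).symm

theorem nhds_le_map_nhds_iterate (hf : IsTranscendentalSelfMap f) (n : ℕ) {z : ℂ}
    (hz : z ∈ puncturedPlane) : 𝓝 (f^[n] z) ≤ map f^[n] (𝓝 z) := by
  induction n with
  | zero => simp
  | succ n ih =>
    rw [Function.iterate_succ', ← Filter.map_map]
    exact (hf.nhds_le_map_nhds (hf.mapsTo_iterate n hz)).trans (map_mono ih)

/-- Otherwise there are `n j → ∞` and points `w j → z` such that the values `f^[n j] (w j)` stay in a
compact subset of `ℂ*`. By normality a subsequence of these values converges to `g z`, where `g` is a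
limit of iterates; but `g z` belongs to the omega-limit set of `z`. -/
theorem exists_ball_iterates_large (hf : IsTranscendentalSelfMap f) {z : ℂ}
    (hI : z ∈ escapingSet f) (hF : z ∈ fatouSet f) (K : ℝ) :
    ∃ r > 0, ball z r ⊆ puncturedPlane ∧
      ∃ N, ∀ n ≥ N, ∀ w ∈ ball z r, K < |Real.log ‖f^[n] w‖| := by
  let _ := riemannSphereUniformSpace
  obtain ⟨U, hU, hzU, hUp, hnorm⟩ := hF
  obtain ⟨r₀, hr₀, hball⟩ := Metric.isOpen_iff.mp hU z hzU
  by_contra hcon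
  have hex : ∀ j : ℕ, ∃ n ≥ j, ∃ w ∈ ball z (r₀ / (j + 1)), |Real.log ‖f^[n] w‖| ≤ K := by
    intro j
    by_contra hj
    push Not at hj
    have hle : r₀ / (j + 1) ≤ r₀ := div_le_self hr₀.le (by linarith [j.cast_nonneg (α := ℝ)])
    exact hcon ⟨r₀ / (j + 1), by positivity, ((ball_subset_ball hle).trans hball).trans hUp, j, hj⟩
  choose n hn w hw hwK using hex
  obtain ⟨φ, hφ, g, hg⟩ := hnorm n
  have hgc : ContinuousOn g U := hg.continuousOn (Frequently.of_forall fun k =>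
    OnePoint.continuous_coe.comp_continuousOn
      ((hf.differentiableOn_iterate _).continuousOn.mono hUp))
  have hgz : g z ∈ omegaLimitSet f z := by
    refine mem_iInter.mpr fun m => mem_closure_of_tendsto (hg.tendsto_at hzU) ?_
    filter_upwards [eventually_ge_atTop m] with k hk
    exact ⟨_, (hk.trans (hφ.id_le k)).trans (hn _), rfl⟩
  have hwlim : Tendsto w atTop (𝓝 z) := by
    rw [tendsto_iff_dist_tendsto_zero]
    refine squeeze_zero (fun _ => dist_nonneg) (fun j => (mem_ball.mp (hw j)).le) ?_
    simpa [div_eq_mul_inv] using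
      (tendsto_one_div_add_atTop_nhds_zero_nat (𝕜 := ℝ)).const_mul r₀
  have hwU : ∀ j, w j ∈ U := fun j => hball (ball_subset_ball
    (div_le_self hr₀.le (by linarith [j.cast_nonneg (α := ℝ)])) (hw j))
  have hlim := hg.tendsto_comp (hgc z hzU) hzU (g := fun k => w (φ k))
    (tendsto_nhdsWithin_iff.mpr ⟨hwlim.comp hφ.tendsto_atTop, Eventually.of_forall fun _ => hwU _⟩)
  have hcomp : IsCompact {u : ℂ | Real.exp (-K) ≤ ‖u‖ ∧ ‖u‖ ≤ Real.exp K} :=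
    (isCompact_closedBall (0 : ℂ) (Real.exp K)).of_isClosed_subset
      ((isClosed_le continuous_const continuous_norm).inter
        (isClosed_le continuous_norm continuous_const)) fun u hu => by simpa using hu.2
  obtain ⟨u, hu, hug⟩ := (hcomp.image OnePoint.continuous_coe).isClosed.mem_of_tendsto hlim
    (Eventually.of_forall fun k => mem_image_of_mem _ (by
      have hpos : 0 < ‖f^[n (φ k)] (w (φ k))‖ :=
        norm_pos_iff.mpr (hf.mapsTo_iterate _ (hUp (hwU _)))
      obtain ⟨h1, h2⟩ := abs_le.mp (hwK (φ k))
      exact ⟨(Real.le_log_iff_exp_le hpos).mp h1, (Real.log_le_iff_le_exp hpos).mp h2⟩))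
  rcases hI.2 hgz with h | h
  · rw [← hug, OnePoint.coe_eq_coe] at h
    rw [h, mem_ofPred_eq, norm_zero] at hu
    exact (Real.exp_pos _).not_ge hu.1
  · rw [mem_singleton_iff, ← hug] at h
    exact OnePoint.coe_ne_infty u h

end IsTranscendentalSelfMap

/-! ### Lifting paths through local homeomorphisms -/

theorem MapClusterPt.eq_of_tendsto {α X : Type*} [TopologicalSpace X] [T2Space X] {F : Filter α}
    {u : α → X} {x y : X} (hx : MapClusterPt x F u) (hy : Tendsto u F (𝓝 y)) : x = y :=
  eq_of_nhds_neBot (NeBot.mono hx (inf_le_inf_left _ hy))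

section PathLifting
variable {X Y : Type*} [TopologicalSpace X] [TopologicalSpace Y] {p : X → Y} {σ : ℝ → Y}

/-- A lift over `[0, t₀]` extends over `[0, s]` if `σ` maps `[t₀, s]` into the target of one chart. -/
theorem exists_lift_extension (hσ : Continuous σ) {γ : ℝ → X} {t₀ s : ℝ} (h0 : 0 ≤ t₀)
    (hts : t₀ ≤ s) (hγ : ContinuousOn γ (Icc 0 t₀)) (hlift : ∀ t ∈ Icc 0 t₀, p (γ t) = σ t)
    {e : OpenPartialHomeomorph X Y} (he : p = e) (hsrc : γ t₀ ∈ e.source)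
    (htgt : ∀ t ∈ Icc t₀ s, σ t ∈ e.target) :
    ∃ γ' : ℝ → X, ContinuousOn γ' (Icc 0 s) ∧ γ' 0 = γ 0 ∧ ∀ t ∈ Icc 0 s, p (γ' t) = σ t := by
  classical
  have hleft : EqOn (fun t => if t ≤ t₀ then γ t else e.symm (σ t)) γ (Icc 0 t₀) :=
    fun t ht => if_pos ht.2
  have hright : EqOn (fun t => if t ≤ t₀ then γ t else e.symm (σ t)) (fun t => e.symm (σ t))
      (Icc t₀ s) := fun t ht => by
    dsimp only
    split_ifs with h
    · obtain rfl : t = t₀ := le_antisymm h ht.1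
      rw [← hlift t ⟨h0, le_rfl⟩, he, e.left_inv hsrc]
    · rfl
  refine ⟨fun t => if t ≤ t₀ then γ t else e.symm (σ t), ?_, if_pos h0, fun t ht => ?_⟩
  · rw [← Icc_union_Icc_eq_Icc h0 hts]
    exact (hγ.congr hleft).union_of_isClosed
      ((e.continuousOn_symm.comp hσ.continuousOn htgt).congr hright) isClosed_Icc isClosed_Icc
  · rcases le_total t t₀ with h | h
    · rw [hleft ⟨ht.1, h⟩, hlift t ⟨ht.1, h⟩]
    · rw [hright ⟨h, ht.2⟩, he, e.right_inv (htgt t ⟨h, ht.2⟩)]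

/-- A path lifts through a local homeomorphism if every partial lift over a half-open interval
`[0, s)` has a cluster point at `s`. -/
theorem IsLocalHomeomorph.exists_lift_of_mapClusterPt [T2Space X] [T2Space Y]
    (hp : IsLocalHomeomorph p)
    (hσ : Continuous σ) {x₀ : X} (hx₀ : p x₀ = σ 0)
    (hcluster : ∀ s ∈ Ioc (0 : ℝ) 1, ∀ γ : ℝ → X, ContinuousOn γ (Ico 0 s) →
      (∀ t ∈ Ico 0 s, p (γ t) = σ t) → ∃ x, MapClusterPt x (𝓝[<] s) γ) :
    ∃ γ : ℝ → X, ContinuousOn γ (Icc 0 1) ∧ γ 0 = x₀ ∧ ∀ t ∈ Icc (0 : ℝ) 1, p (γ t) = σ t := by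
  let P : ℝ → Prop := fun s =>
    ∃ γ : ℝ → X, ContinuousOn γ (Icc 0 s) ∧ γ 0 = x₀ ∧ ∀ t ∈ Icc 0 s, p (γ t) = σ t
  have hmono : ∀ {s t : ℝ}, t ≤ s → P s → P t := fun hts ⟨γ, hγ, hγ0, hl⟩ =>
    ⟨γ, hγ.mono (Icc_subset_Icc_right hts), hγ0, fun u hu => hl u ⟨hu.1, hu.2.trans hts⟩⟩
  have hP0 : P 0 := ⟨fun _ => x₀, continuousOn_const, rfl, fun t ht => by
    rw [le_antisymm ht.2 ht.1, hx₀]⟩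
  have hclosed : ∀ s ∈ Ioc (0 : ℝ) 1, (∀ t ∈ Ico 0 s, P t) → P s := by
    intro s hs hlt
    have : Nonempty X := ⟨x₀⟩
    choose! Γ hΓc hΓ0 hΓl using hlt
    -- By uniqueness of lifts, the lifts over the intervals `[0, t]` fit together.
    have hagree : ∀ t ∈ Ico 0 s, EqOn (fun u => Γ u u) (Γ t) (Icc 0 t) := fun t ht u hu =>
      (T2Space.isSeparatedMap p).eqOn_of_comp_eqOn hp.isLocallyInjective
        (isPreconnected_Icc (a := 0) (b := u)) (hΓc u ⟨hu.1, hu.2.trans_lt ht.2⟩)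
        ((hΓc t ht).mono (Icc_subset_Icc_right hu.2))
        (fun v hv => (hΓl u ⟨hu.1, hu.2.trans_lt ht.2⟩ v hv).trans
          (hΓl t ht v ⟨hv.1, hv.2.trans hu.2⟩).symm)
        (left_mem_Icc.mpr hu.1)
        ((hΓ0 u ⟨hu.1, hu.2.trans_lt ht.2⟩).trans (hΓ0 t ht).symm) (right_mem_Icc.mpr hu.1)
    have hcont : ContinuousOn (fun u => Γ u u) (Ico 0 s) := by
      intro u hu
      obtain ⟨t, hut, hts⟩ := exists_between hu.2
      have ht : t ∈ Ico 0 s := ⟨hu.1.trans hut.le, hts⟩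
      refine (((hΓc t ht).congr (hagree t ht)) u ⟨hu.1, hut.le⟩).mono_of_mem_nhdsWithin ?_
      filter_upwards [self_mem_nhdsWithin, mem_nhdsWithin_of_mem_nhds (Iio_mem_nhds hut)]
        with v hv hv' using ⟨hv.1, le_of_lt hv'⟩
    have hlift : ∀ t ∈ Ico 0 s, p (Γ t t) = σ t := fun t ht => hΓl t ht t ⟨ht.1, le_rfl⟩
    obtain ⟨x, hx⟩ := hcluster s hs _ hcont hlift
    obtain ⟨e, hxe, he⟩ := hp x
    -- The path `p ∘ γ = σ` converges at `s`, so its limit is the image of the cluster point.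
    have hev : ∀ᶠ t in 𝓝[<] s, p (Γ t t) = σ t := by
      filter_upwards [Ico_mem_nhdsLT hs.1] with t ht using hlift t ht
    have hσs : Tendsto σ (𝓝[<] s) (𝓝 (σ s)) := hσ.continuousAt.mono_left nhdsWithin_le_nhds
    have hpx : p x = σ s :=
      (hx.continuousAt_comp hp.continuous.continuousAt).eq_of_tendsto
        (hσs.congr' (hev.mono fun _ ht => ht.symm))
    have htgt : σ s ∈ e.target := by rw [← hpx, he]; exact e.map_source hxe
    obtain ⟨l, hl, hlt⟩ := exists_Ioc_subset_of_mem_nhds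
      ((e.open_target.preimage hσ).mem_nhds htgt) (exists_lt s)
    obtain ⟨t, htsrc, ht0, htl⟩ := ((mapClusterPt_iff_frequently.mp hx _
      (e.open_source.mem_nhds hxe)).and_eventually
      (inter_mem (Ico_mem_nhdsLT hs.1) (Ioo_mem_nhdsLT hl))).exists
    obtain ⟨γ', hγ', hγ'0, hγ'l⟩ := exists_lift_extension hσ ht0.1 ht0.2.le
      ((hcont.mono (fun u hu => ⟨hu.1, hu.2.trans_lt ht0.2⟩)))
      (fun u hu => hlift u ⟨hu.1, hu.2.trans_lt ht0.2⟩) he htsrc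
      (fun u hu => hlt ⟨htl.1.trans_le hu.1, hu.2⟩)
    exact ⟨γ', hγ', hγ'0.trans (hΓ0 0 ⟨le_rfl, hs.1⟩), hγ'l⟩
  have hopen : ∀ s ∈ Ico (0 : ℝ) 1, P s → ∃ s' ∈ Ioc s 1, P s' := by
    rintro s hs ⟨γ, hγ, hγ0, hl⟩
    obtain ⟨e, hxe, he⟩ := hp (γ s)
    have htgt : σ s ∈ e.target := by
      rw [← hl s ⟨hs.1, le_rfl⟩, he]; exact e.map_source hxe
    obtain ⟨u, hu, hsub⟩ := exists_Ico_subset_of_mem_nhds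
      ((e.open_target.preimage hσ).mem_nhds htgt) (exists_gt s)
    obtain ⟨v, hsv, hv⟩ := exists_between (lt_min hu hs.2)
    obtain ⟨γ', h1, h2, h3⟩ := exists_lift_extension hσ hs.1 hsv.le hγ hl he hxe
      (fun t ht => hsub ⟨ht.1, ht.2.trans_lt (hv.trans_le (min_le_left _ _))⟩)
    exact ⟨v, ⟨hsv, hv.le.trans (min_le_right _ _)⟩, γ', h1, h2.trans hγ0, h3⟩
  let S : Set ℝ := {s | s ∈ Icc (0 : ℝ) 1 ∧ P s}
  have hbdd : BddAbove S := ⟨1, fun s hs => hs.1.2⟩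
  have h0S : (0 : ℝ) ∈ S := ⟨⟨le_rfl, zero_le_one⟩, hP0⟩
  have hT0 : 0 ≤ sSup S := le_csSup hbdd h0S
  have hT1 : sSup S ≤ 1 := csSup_le ⟨0, h0S⟩ fun s hs => hs.1.2
  have hPT : P (sSup S) := by
    rcases hT0.eq_or_lt with h | h
    · rwa [← h]
    · refine hclosed _ ⟨h, hT1⟩ fun t ht => ?_
      obtain ⟨s, hs, hts⟩ := exists_lt_of_lt_csSup ⟨0, h0S⟩ ht.2
      exact hmono hts.le hs.2
  rcases hT1.eq_or_lt with h | h
  · rwa [h] at hPT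
  · obtain ⟨s', hs', hPs'⟩ := hopen _ ⟨hT0, h⟩ hPT
    exact absurd (le_csSup hbdd (show s' ∈ S from ⟨⟨hT0.trans hs'.1.le, hs'.2⟩, hPs'⟩))
      (not_le.mpr hs'.1)

end PathLifting

/-! ### Asymptotic values from curves that leave every compact set -/

/-- A curve without cluster points in `ℂ*` satisfies `|log |γ|| → ∞`, and by the intermediate value
theorem `log |γ|` has a constant sign near the end; so `γ` tends to `0` or to `∞`. -/
theorem mem_asymptoticValues_of_not_mapClusterPt {f : ℂ → ℂ} {γ : ℝ → ℂ} {s₀ s : ℝ} {a : ℂ}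
    (hs : s₀ < s) (hγ : ContinuousOn γ (Ioo s₀ s)) (hγp : MapsTo γ (Ioo s₀ s) puncturedPlane)
    (hinj : InjOn γ (Ioo s₀ s)) (ha : a ∈ puncturedPlane)
    (hlim : Tendsto (fun t => f (γ t)) (𝓝[<] s) (𝓝 a))
    (hcl : ∀ x ∈ puncturedPlane, ¬ MapClusterPt x (𝓝[<] s) γ) : a ∈ asymptoticValues f := by
  have hlarge : ∀ K : ℝ, ∀ᶠ t in 𝓝[<] s, K < |Real.log ‖γ t‖| := by
    intro K
    by_contra hcon
    have hcomp : IsCompact {u : ℂ | Real.exp (-K) ≤ ‖u‖ ∧ ‖u‖ ≤ Real.exp K} :=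
      (isCompact_closedBall (0 : ℂ) (Real.exp K)).of_isClosed_subset
        ((isClosed_le continuous_const continuous_norm).inter
          (isClosed_le continuous_norm continuous_const)) fun u hu => by simpa using hu.2
    obtain ⟨x, hx, hxc⟩ := hcomp.exists_mapClusterPt_of_frequently
      (((not_eventually.mp hcon).and_eventually (Ioo_mem_nhdsLT hs)).mono fun t ⟨ht, hts⟩ => by
        have hpos : 0 < ‖γ t‖ := norm_pos_iff.mpr (hγp hts)
        obtain ⟨h1, h2⟩ := abs_le.mp (not_lt.mp ht)
        exact ⟨(Real.le_log_iff_exp_le hpos).mp h1, (Real.log_le_iff_le_exp hpos).mp h2⟩)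
    exact hcl x (norm_pos_iff.mp ((Real.exp_pos _).trans_le hx.1)) hxc
  obtain ⟨s₁, hs₁, hsub⟩ := mem_nhdsLT_iff_exists_Ioo_subset.mp
    (inter_mem (hlarge 0) (Ioo_mem_nhdsLT hs))
  have hs₁' : s₁ < s := hs₁
  have hIoo : Ioo s₁ s ⊆ Ioo s₀ s := fun t ht => (hsub ht).2
  have hlogc : ContinuousOn (fun t => Real.log ‖γ t‖) (Ioo s₁ s) :=
    (hγ.mono hIoo).norm.log fun t ht => norm_ne_zero_iff.mpr (hγp (hIoo ht))
  have htends : Tendsto γ (𝓝[<] s) (𝓝 0) ∨ Tendsto γ (𝓝[<] s) (cocompact ℂ) := by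
    have hev := Ioo_mem_nhdsLT hs₁'
    by_cases hsign : ∀ t ∈ Ioo s₁ s, 0 < Real.log ‖γ t‖
    · right
      rw [← Metric.cobounded_eq_cocompact, ← tendsto_norm_atTop_iff_cobounded]
      have h1 : Tendsto (fun t => Real.log ‖γ t‖) (𝓝[<] s) atTop :=
        tendsto_atTop.mpr fun K => by
          filter_upwards [hlarge K, hev] with t ht hts
          rw [abs_of_pos (hsign t hts)] at ht
          exact ht.le
      refine (Real.tendsto_exp_atTop.comp h1).congr' ?_
      filter_upwards [hev] with t ht
      exact Real.exp_log (norm_pos_iff.mpr (hγp (hIoo ht)))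
    · left
      push Not at hsign
      obtain ⟨t₁, ht₁, hneg⟩ := hsign
      have hsign' : ∀ t ∈ Ioo s₁ s, Real.log ‖γ t‖ < 0 := by
        intro t ht
        by_contra hpos
        obtain ⟨u, hu, hu0⟩ := isPreconnected_Ioo.intermediate_value ht₁ ht hlogc
          ⟨hneg, not_lt.mp hpos⟩
        have : 0 < |Real.log ‖γ u‖| := (hsub hu).1
        simp only at hu0
        rw [hu0, abs_zero] at this
        exact this.false
      rw [tendsto_zero_iff_norm_tendsto_zero]
      have h1 : Tendsto (fun t => Real.log ‖γ t‖) (𝓝[<] s) atBot :=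
        tendsto_atBot.mpr fun K => by
          filter_upwards [hlarge (-K), hev] with t ht hts
          rw [abs_of_neg (hsign' t hts)] at ht
          linarith
      refine (Real.tendsto_exp_atBot.comp h1).congr' ?_
      filter_upwards [hev] with t ht
      exact Real.exp_log (norm_pos_iff.mpr (hγp (hIoo ht)))
  -- Reparametrize the end `(s₁, s)` of the curve by `(0, ∞)`.
  have hd : 0 < s - s₁ := sub_pos.mpr hs₁'
  have hmaps : MapsTo (fun t : ℝ => s - (s - s₁) / (1 + t)) (Ioi 0) (Ioo s₁ s) := by
    intro t ht
    have ht' : 0 < t := ht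
    have h1 : (s - s₁) / (1 + t) < s - s₁ := div_lt_self hd (by linarith)
    have h2 : 0 < (s - s₁) / (1 + t) := by positivity
    exact ⟨by linarith, by linarith⟩
  have hτ : Tendsto (fun t : ℝ => s - (s - s₁) / (1 + t)) atTop (𝓝[<] s) := by
    refine tendsto_nhdsWithin_iff.mpr ⟨?_, ?_⟩
    · have h1 : Tendsto (fun t : ℝ => (s - s₁) / (1 + t)) atTop (𝓝 0) :=
        tendsto_const_nhds.div_atTop (tendsto_atTop_add_const_left _ _ tendsto_id)
      simpa using tendsto_const_nhds.sub h1
    · filter_upwards [eventually_gt_atTop 0] with t ht using (hmaps ht).2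
  refine ⟨ha, fun t => γ (s - (s - s₁) / (1 + t)), ?_, ?_, ?_, ?_, hlim.comp hτ⟩
  · refine (hγ.mono hIoo).comp (fun t ht => ?_) hmaps
    have ht' : (0 : ℝ) < t := ht
    have : 1 + t ≠ 0 := by positivity
    exact (by fun_prop (disch := assumption) :
      ContinuousAt (fun t : ℝ => s - (s - s₁) / (1 + t)) t).continuousWithinAt
  · refine (hinj.mono hIoo).comp (fun t ht u hu htu => ?_) hmaps
    have ht' : (0 : ℝ) < t := ht
    have hu' : (0 : ℝ) < u := hu
    simp only [sub_right_inj] at htu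
    rw [div_eq_div_iff (by positivity) (by positivity)] at htu
    linarith [mul_left_cancel₀ hd.ne' htu]
  · exact (hγp.mono_left hIoo).comp hmaps
  · exact htends.imp (fun h => h.comp hτ) (fun h => h.comp hτ)

/-! ### Inverse branches over discs in logarithmic coordinates -/

theorem log_norm_exp (w : ℂ) : Real.log ‖Complex.exp w‖ = w.re := by
  rw [Complex.norm_exp, Real.log_exp]

theorem exp_segment_injOn {w d : ℂ} (hd : d ≠ 0) {a b : ℝ} (hab : b - a ≤ 1 / ‖d‖) :
    InjOn (fun t : ℝ => Complex.exp (w + t * d)) (Ioo a b) := by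
  intro t ht u hu htu
  have hdpos : 0 < ‖d‖ := norm_pos_iff.mpr hd
  obtain ⟨n, hn⟩ := Complex.exp_eq_exp_iff_exists_int.mp htu
  have h1 : ((t - u : ℝ) : ℂ) * d = n * (2 * Real.pi * Complex.I) := by
    push_cast; linear_combination hn
  have h2 : |t - u| * ‖d‖ < 1 := by
    have h3 : |t - u| < 1 / ‖d‖ :=
      (abs_sub_lt_iff.mpr ⟨by linarith [ht.2, hu.1], by linarith [ht.1, hu.2]⟩).trans_le hab
    rwa [lt_div_iff₀ hdpos] at h3
  have h3 : |t - u| * ‖d‖ = |(n : ℝ)| * (2 * Real.pi) := by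
    have h4 := congrArg norm h1
    rw [norm_mul, Complex.norm_real, Real.norm_eq_abs] at h4
    simpa [Real.pi_pos.le, abs_of_nonneg] using h4
  have hn0 : n = 0 := by
    by_contra hne
    have h4 : (1 : ℝ) ≤ |(n : ℝ)| := by exact_mod_cast Int.one_le_abs hne
    nlinarith [Real.pi_gt_three]
  rw [hn0, Int.cast_zero, zero_mul, mul_eq_zero, or_iff_left hd] at h1
  exact sub_eq_zero.mp (by exact_mod_cast h1)

/-- Near `w` the function `g` is a right inverse of `f` up to `exp`, so it is a local inverse of the
branch `log (f · exp (-w)) + w`, whose derivative at `g w` does not vanish. -/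
theorem differentiableAt_of_comp_eq_exp {f g : ℂ → ℂ} {w f' : ℂ} (hg : ContinuousAt g w)
    (hf : HasDerivAt f f' (g w)) (hf' : f' ≠ 0)
    (hfg : ∀ᶠ y in 𝓝 w, f (g y) = Complex.exp y) : DifferentiableAt ℂ g w := by
  have hw : f (g w) * Complex.exp (-w) = 1 := by
    rw [hfg.self_of_nhds, ← Complex.exp_add, add_neg_cancel, Complex.exp_zero]
  have hφ : HasDerivAt (fun z => Complex.log (f z * Complex.exp (-w)) + w)
      (f' * Complex.exp (-w) / (f (g w) * Complex.exp (-w))) (g w) :=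
    ((hf.mul_const _).clog (by rw [hw]; exact Complex.one_mem_slitPlane)).add_const w
  refine (HasDerivAt.of_local_left_inverse hg hφ ?_ ?_).differentiableAt
  · rw [hw, div_one]
    exact mul_ne_zero hf' (Complex.exp_ne_zero _)
  · filter_upwards [hfg, ball_mem_nhds w Real.pi_pos] with y hy hyw
    have him : |(y - w).im| < Real.pi :=
      (Complex.abs_im_le_norm _).trans_lt (by rwa [mem_ball, dist_eq_norm] at hyw)
    rw [hy, ← Complex.exp_add, ← sub_eq_add_neg, Complex.log_exp (abs_lt.mp him).1
      (abs_lt.mp him).2.le, sub_add_cancel]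

namespace IsTranscendentalSelfMap
variable {f : ℂ → ℂ}

theorem isOpen_log_norm_large (hf : IsTranscendentalSelfMap f) (Λ : ℝ) :
    IsOpen {z : ℂ | z ∈ puncturedPlane ∧ Λ < |Real.log ‖f z‖|} := by
  have hc : ContinuousOn (fun z => |Real.log ‖f z‖|) puncturedPlane :=
    (hf.differentiableOn.continuousOn.norm.log
      fun z hz => norm_ne_zero_iff.mpr (hf.mapsTo hz)).abs
  exact hc.isOpen_inter_preimage isOpen_puncturedPlane isOpen_Ioi

theorem isLocalHomeomorph_restrict (hf : IsTranscendentalSelfMap f) {Λ : ℝ}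
    (hΛ : ∀ v ∈ singularValues f, |Real.log ‖v‖| ≤ Λ) :
    IsLocalHomeomorph
      fun x : {z : ℂ | z ∈ puncturedPlane ∧ Λ < |Real.log ‖f z‖|} => f x := by
  have hon : IsLocalHomeomorphOn f {z : ℂ | z ∈ puncturedPlane ∧ Λ < |Real.log ‖f z‖|} := by
    intro z hz
    have hd : HasStrictDerivAt f (deriv f z) z :=
      (hf.differentiableOn.analyticAt (isOpen_puncturedPlane.mem_nhds hz.1)).hasStrictDerivAt
    have hne : deriv f z ≠ 0 := fun h0 =>
      (hΛ _ (Or.inl ⟨z, ⟨hz.1, h0⟩, rfl⟩)).not_gt hz.2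
    have hd' := hd.hasStrictFDerivAt_equiv hne
    exact ⟨hd'.toOpenPartialHomeomorph f, hd'.mem_toOpenPartialHomeomorph_source,
      hd'.toOpenPartialHomeomorph_coe.symm⟩
  rw [isLocalHomeomorph_iff_isLocalHomeomorphOn_univ]
  exact hon.comp (hf.isOpen_log_norm_large
    Λ).isOpenEmbedding_subtypeVal.isLocalHomeomorph.isLocalHomeomorphOn fun x _ => x.2

/-- If a lift broke off at the parameter `s`, it would leave every compact subset of `ℂ*`, and the
value `exp (w + s d)` would be an asymptotic value. -/
theorem exists_lift_exp_segment (hf : IsTranscendentalSelfMap f) {Λ : ℝ}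
    (hΛ : ∀ v ∈ singularValues f, |Real.log ‖v‖| ≤ Λ) {w d : ℂ}
    (hseg : ∀ t ∈ Icc (0 : ℝ) 1, Λ < |(w + t * d).re|)
    (u : {z : ℂ | z ∈ puncturedPlane ∧ Λ < |Real.log ‖f z‖|}) (hu : f u = Complex.exp w) :
    ∃ γ : ℝ → {z : ℂ | z ∈ puncturedPlane ∧ Λ < |Real.log ‖f z‖|},
      ContinuousOn γ (Icc 0 1) ∧ γ 0 = u ∧
        ∀ t ∈ Icc (0 : ℝ) 1, f (γ t) = Complex.exp (w + t * d) := by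
  rcases eq_or_ne d 0 with rfl | hd
  · exact ⟨fun _ => u, continuousOn_const, rfl, fun t _ => by simpa using hu⟩
  have hσ : Continuous fun t : ℝ => Complex.exp (w + t * d) := by fun_prop
  refine (hf.isLocalHomeomorph_restrict hΛ).exists_lift_of_mapClusterPt hσ (by simpa using hu)
    fun s hs γ hγ hlift => ?_
  by_contra hcon
  have hdpos : 0 < ‖d‖ := norm_pos_iff.mpr hd
  have hIoo : Ioo (max 0 (s - 1 / ‖d‖)) s ⊆ Ico 0 s := fun t ht =>
    ⟨(le_max_left _ _).trans ht.1.le, ht.2⟩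
  have hmax : max 0 (s - 1 / ‖d‖) < s :=
    max_lt hs.1 (sub_lt_self _ (by positivity))
  have hlim : Tendsto (fun t => f (γ t)) (𝓝[<] s) (𝓝 (Complex.exp (w + s * d))) := by
    refine (hσ.continuousAt.mono_left nhdsWithin_le_nhds).congr' ?_
    filter_upwards [Ico_mem_nhdsLT hs.1] with t ht using (hlift t ht).symm
  have hasym : Complex.exp (w + s * d) ∈ asymptoticValues f := by
    refine mem_asymptoticValues_of_not_mapClusterPt (γ := fun t => (γ t : ℂ)) hmax
      (continuous_subtype_val.comp_continuousOn (hγ.mono hIoo)) (fun t _ => (γ t).2.1)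
      (fun t ht t' ht' htt => ?_) (Complex.exp_ne_zero _) hlim fun x hx hxc => ?_
    · refine exp_segment_injOn (w := w) hd ?_ ht ht' ?_
      · linarith [le_max_right 0 (s - 1 / ‖d‖)]
      · have h1 := congrArg f htt
        rwa [hlift t (hIoo ht), hlift t' (hIoo ht')] at h1
    · have hfx : f x = Complex.exp (w + s * d) :=
        (hxc.continuousAt_comp (hf.differentiableOn.differentiableAt
          (isOpen_puncturedPlane.mem_nhds hx)).continuousAt).eq_of_tendsto hlim
      have hxD : x ∈ {z : ℂ | z ∈ puncturedPlane ∧ Λ < |Real.log ‖f z‖|} :=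
        ⟨hx, by rw [hfx, log_norm_exp]; exact hseg s ⟨hs.1.le, hs.2⟩⟩
      refine hcon ⟨⟨x, hxD⟩, mapClusterPt_iff_frequently.mpr fun V hV => ?_⟩
      obtain ⟨W, hW, hWV⟩ := (mem_nhds_subtype _ _ _).mp hV
      exact (mapClusterPt_iff_frequently.mp hxc W hW).mono fun t ht => hWV ht
  have := hΛ _ (Or.inr hasym)
  rw [log_norm_exp] at this
  exact this.not_gt (hseg s ⟨hs.1.le, hs.2⟩)

/-- The lifts of the radial segments of the disc depend continuously on their end points by
`IsLocalHomeomorph.continuous_lift`, and their end points define the branch. -/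
theorem exists_inverse_branch (hf : IsTranscendentalSelfMap f) {Λ : ℝ}
    (hΛ : ∀ v ∈ singularValues f, |Real.log ‖v‖| ≤ Λ) {w₀ u : ℂ} {M : ℝ} (hM : 0 < M)
    (hball : ∀ w ∈ ball w₀ M, Λ < |w.re|) (hu : u ∈ puncturedPlane)
    (hfu : f u = Complex.exp w₀) :
    ∃ g : ℂ → ℂ, DifferentiableOn ℂ g (ball w₀ M) ∧ g w₀ = u ∧
      MapsTo g (ball w₀ M) puncturedPlane ∧ ∀ w ∈ ball w₀ M, f (g w) = Complex.exp w := by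
  classical
  set D := {z : ℂ | z ∈ puncturedPlane ∧ Λ < |Real.log ‖f z‖|}
  have huD : u ∈ D := ⟨hu, by rw [hfu, log_norm_exp]; exact hball _ (mem_ball_self hM)⟩
  have hseg : ∀ a : ball w₀ M, ∀ t ∈ Icc (0 : ℝ) 1, Λ < |(w₀ + t * (a - w₀)).re| :=
    fun a t ht => hball _ (by
      simpa using (convex_ball w₀ M).add_smul_sub_mem (mem_ball_self hM) a.2 ht)
  choose Γ hΓc hΓ0 hΓl using fun a : ball w₀ M =>
    hf.exists_lift_exp_segment hΛ (hseg a) ⟨u, huD⟩ hfu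
  let σ : C(unitInterval × ball w₀ M, ℂ) :=
    ⟨fun q => Complex.exp (w₀ + (q.1 : ℝ) * ((q.2 : ℂ) - w₀)), by fun_prop⟩
  have hcont : Continuous fun q : unitInterval × ball w₀ M => Γ q.2 q.1 :=
    (hf.isLocalHomeomorph_restrict hΛ).continuous_lift (T2Space.isSeparatedMap _) σ
      (funext fun q => hΓl q.2 q.1 q.1.2)
      (by simpa [hΓ0] using continuous_const)
      (fun a => (hΓc a).comp_continuous continuous_subtype_val fun t => t.2)
  obtain ⟨g, hg⟩ : ∃ g : ℂ → ℂ, ∀ a : ball w₀ M, g a = Γ a 1 :=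
    ⟨fun w => if h : w ∈ ball w₀ M then Γ ⟨w, h⟩ 1 else 0, fun a => by simp [a.2]⟩
  have hgc : ContinuousOn g (ball w₀ M) := by
    rw [continuousOn_iff_continuous_domRestrict]
    refine (continuous_subtype_val.comp (hcont.comp (Continuous.prodMk_right 1))).congr fun a => ?_
    exact (hg a).symm
  have hgl : ∀ w ∈ ball w₀ M, f (g w) = Complex.exp w := fun w hw => by
    rw [hg ⟨w, hw⟩, hΓl ⟨w, hw⟩ 1 (right_mem_Icc.mpr zero_le_one)]
    simp
  have hgD : MapsTo g (ball w₀ M) D := fun w hw => by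
    rw [hg ⟨w, hw⟩]; exact (Γ ⟨w, hw⟩ 1).2
  refine ⟨g, fun w hw => ?_, ?_, fun w hw => (hgD hw).1, hgl⟩
  · have hnhds := isOpen_ball.mem_nhds hw
    refine (differentiableAt_of_comp_eq_exp (hgc.continuousAt hnhds)
      (hf.differentiableOn.differentiableAt
        (isOpen_puncturedPlane.mem_nhds (hgD hw).1)).hasDerivAt (fun h0 => ?_)
      (eventually_of_mem hnhds hgl)).differentiableWithinAt
    exact (hΛ _ (Or.inl ⟨g w, ⟨(hgD hw).1, h0⟩, rfl⟩)).not_gt (hgD hw).2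
  · -- The lift of the constant path is constant.
    have hconst : EqOn (Γ ⟨w₀, mem_ball_self hM⟩) (fun _ => ⟨u, huD⟩) (Icc 0 1) :=
      (T2Space.isSeparatedMap _).eqOn_of_comp_eqOn
        (hf.isLocalHomeomorph_restrict hΛ).isLocallyInjective isPreconnected_Icc (hΓc _)
        continuousOn_const
        (fun t ht => by simpa [hfu] using hΓl ⟨w₀, mem_ball_self hM⟩ t ht)
        (left_mem_Icc.mpr zero_le_one) (hΓ0 _)
    rw [hg ⟨w₀, mem_ball_self hM⟩, hconst (right_mem_Icc.mpr zero_le_one)]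

/-! ### Expansion -/

/-- The derivative of `f` in logarithmic coordinates, `u f'(u) / f u`, is at least `2` in modulus
wherever `f u` is sufficiently close to `0` or `∞`. -/
theorem two_le_norm_logDeriv (hf : IsTranscendentalSelfMap f) {K Λ : ℝ} (hK : 0 ≤ K)
    (hcirc : ∀ t : ℝ, 0 < t → K < |Real.log t| → ∃ p, ‖p‖ = t ∧ ‖f p‖ = 1) (hΛ0 : 0 ≤ Λ)
    (hΛ : ∀ v ∈ singularValues f, |Real.log ‖v‖| ≤ Λ) {u : ℂ} (hu : u ∈ puncturedPlane)
    (hlarge : Λ + 192 * (K + 5) < |Real.log ‖f u‖|) : 2 ≤ ‖u * logDeriv f u‖ := by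
  have hM : 0 < 192 * (K + 5) := by positivity
  have hfu : f u = Complex.exp (Complex.log (f u)) := (Complex.exp_log (hf.mapsTo hu)).symm
  have hball : ∀ w ∈ ball (Complex.log (f u)) (192 * (K + 5)), Λ < |w.re| := fun w hw => by
    rw [mem_ball, dist_eq_norm] at hw
    have h1 := (Complex.abs_re_le_norm _).trans_lt hw
    have h2 := abs_sub_abs_le_abs_sub (Complex.log (f u)).re w.re
    rw [abs_sub_comm, ← Complex.sub_re, Complex.log_re] at h2
    linarith
  obtain ⟨g, hgd, hg0, hgm, hgl⟩ := hf.exists_inverse_branch hΛ hM hball hu hfu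
  obtain ⟨l, hld, hl⟩ := exists_differentiableOn_exp_eq hgd hgm
  set w₀ := Complex.log (f u)
  have hw₀ : w₀ ∈ ball w₀ (192 * (K + 5)) := mem_ball_self hM
  have hnhds := isOpen_ball.mem_nhds hw₀
  have hexpl : ∀ w ∈ ball w₀ (192 * (K + 5)), f (Complex.exp (l w)) = Complex.exp w :=
    fun w hw => by rw [hl w hw, hgl w hw]
  have hl0 : Complex.exp (l w₀) = u := by rw [hl w₀ hw₀, hg0]
  have hprod : u * logDeriv f u * deriv l w₀ = 1 := by
    have h1 : HasDerivAt (fun w => f (Complex.exp (l w)))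
        (deriv f u * (u * deriv l w₀)) w₀ := by
      have h2 := (hld.differentiableAt hnhds).hasDerivAt.cexp
      rw [hl0] at h2
      refine HasDerivAt.comp w₀ ?_ h2
      rw [hl0]
      exact (hf.differentiableOn.differentiableAt
        (isOpen_puncturedPlane.mem_nhds hu)).hasDerivAt
    have h2 : HasDerivAt (fun w => f (Complex.exp (l w))) (Complex.exp w₀) w₀ :=
      (Complex.hasDerivAt_exp w₀).congr_of_eventuallyEq (eventually_of_mem hnhds hexpl)
    have h3 := h1.unique h2
    rw [← hfu] at h3
    have hne : f u ≠ 0 := hf.mapsTo hu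
    rw [logDeriv_apply]
    field_simp
    linear_combination h3
  have hl'0 : deriv l w₀ ≠ 0 := right_ne_zero_of_mul_eq_one hprod
  have hl' : ‖deriv l w₀‖ ≤ 1 / 2 := by
    by_contra hcon
    rw [not_le] at hcon
    obtain ⟨c, hc⟩ := exists_ball_subset_image_of_deriv_ne_zero hM hld hl'0
    obtain ⟨x, hx, hx1⟩ := exists_mem_ball_norm_exp_eq_one hK hcirc c
    obtain ⟨w, hw, rfl⟩ := hc (ball_subset_ball (by nlinarith) hx)
    have h1 := hball w hw
    rw [hexpl w hw, Complex.norm_exp, Real.exp_eq_one_iff] at hx1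
    rw [hx1, abs_zero] at h1
    exact h1.not_ge hΛ0
  have hnorm := congrArg norm hprod
  rw [norm_mul, norm_one] at hnorm
  nlinarith [norm_nonneg (u * logDeriv f u)]

/-- The chain rule in logarithmic coordinates. -/
theorem logDeriv_iterate_succ (hf : IsTranscendentalSelfMap f) (n : ℕ) {z : ℂ}
    (hz : z ∈ puncturedPlane) :
    z * logDeriv f^[n + 1] z = (f^[n] z * logDeriv f (f^[n] z)) * (z * logDeriv f^[n] z) := by
  have hn := hf.mapsTo_iterate n hz
  have hne : f^[n] z ≠ 0 := hn
  have h1 := logDeriv_comp (f := f) (g := f^[n])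
    (hf.differentiableOn.differentiableAt (isOpen_puncturedPlane.mem_nhds hn))
    ((hf.differentiableOn_iterate n).differentiableAt (isOpen_puncturedPlane.mem_nhds hz))
  rw [← Function.iterate_succ'] at h1
  rw [h1, logDeriv_apply f^[n]]
  field_simp

end IsTranscendentalSelfMap

theorem IsBoundedType.exists_abs_log_norm_le {f : ℂ → ℂ} (hf : IsBoundedType f) :
    ∃ Λ : ℝ, 0 ≤ Λ ∧ ∀ v ∈ singularValues f, |Real.log ‖v‖| ≤ Λ := by
  obtain ⟨r, R, hr, hsub⟩ := hf.bounded
  refine ⟨|Real.log r| + |Real.log R|, by positivity, fun v hv => ?_⟩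
  obtain ⟨h1, h2⟩ := hsub hv
  have h3 := Real.log_le_log hr h1
  have h4 := Real.log_le_log (hr.trans_le h1) h2
  rw [abs_le]
  constructor <;> linarith [neg_abs_le (Real.log r), le_abs_self (Real.log R),
    abs_nonneg (Real.log r), abs_nonneg (Real.log R)]

/-! ### Escaping points lie in the Julia set -/

theorem theorem1p1 (f : ℂ → ℂ) (hf : IsBoundedType f) : escapingSet f ⊆ juliaSet f := by
  intro z hI
  refine ⟨hI.1, fun hF => ?_⟩
  have hT := hf.transcendental
  obtain ⟨Λ, hΛ0, hΛ⟩ := hf.exists_abs_log_norm_le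
  obtain ⟨K, hK, hcirc⟩ := hT.exists_norm_eq_one_on_circles
  obtain ⟨r, hr, hrp, N, hN⟩ := hT.exists_ball_iterates_large hI hF (Λ + 192 * (K + 5))
  -- By the open mapping theorem, the orbit may be started at the point `f^[N] z`.
  obtain ⟨ρ, hρ, hsub⟩ := Metric.mem_nhds_iff.mp
    (hT.nhds_le_map_nhds_iterate N hI.1 (image_mem_map (ball_mem_nhds z hr)))
  set z₁ := f^[N] z
  have hz₁ : z₁ ∈ ball z₁ ρ := mem_ball_self hρ
  have hp : ball z₁ ρ ⊆ puncturedPlane := fun w hw => by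
    obtain ⟨v, hv, rfl⟩ := hsub hw
    exact hT.mapsTo_iterate N (hrp hv)
  have hesc : ∀ n, ∀ w ∈ ball z₁ ρ, Λ + 192 * (K + 5) < |Real.log ‖f^[n] w‖| := fun n w hw => by
    obtain ⟨v, hv, rfl⟩ := hsub hw
    rw [← Function.iterate_add_apply]
    exact hN _ (Nat.le_add_left _ _) v hv
  have hz₁0 : z₁ ≠ 0 := hp hz₁
  have hgrowth : ∀ n, (2 : ℝ) ^ n ≤ ‖z₁ * logDeriv f^[n] z₁‖ := by
    intro n
    induction n with
    | zero => simp [logDeriv_apply, hz₁0]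
    | succ n ih =>
      have h1 := hT.two_le_norm_logDeriv hK hcirc hΛ0 hΛ (hT.mapsTo_iterate n (hp hz₁))
        (by simpa [Function.iterate_succ_apply'] using hesc (n + 1) z₁ hz₁)
      rw [hT.logDeriv_iterate_succ n (hp hz₁), norm_mul, pow_succ']
      gcongr
  have hz₁pos : 0 < ‖z₁‖ := norm_pos_iff.mpr hz₁0
  -- For this `n`, the image of a logarithm of `f^[n]` contains a disc of radius `K + 5`.
  obtain ⟨n, hn⟩ := pow_unbounded_of_one_lt ((K + 5) * 96 / ρ * ‖z₁‖) one_lt_two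
  obtain ⟨l, hld, hl⟩ := exists_differentiableOn_exp_eq ((hT.differentiableOn_iterate n).mono hp)
    fun w hw => hT.mapsTo_iterate n (hp hw)
  have hnhds := isOpen_ball.mem_nhds hz₁
  have hl' : deriv l z₁ = logDeriv f^[n] z₁ := by
    have h1 := (hld.differentiableAt hnhds).hasDerivAt.cexp.congr_of_eventuallyEq
      (eventually_of_mem hnhds fun w hw => (hl w hw).symm)
    rw [logDeriv_apply, h1.deriv, hl z₁ hz₁, mul_div_cancel_left₀]
    exact hT.mapsTo_iterate n (hp hz₁)
  have hlarge : (K + 5) * 96 / ρ < ‖deriv l z₁‖ := by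
    have h1 := hn.trans_le (hgrowth n)
    rw [norm_mul, mul_comm ‖z₁‖] at h1
    rw [hl']
    exact lt_of_mul_lt_mul_right h1 hz₁pos.le
  obtain ⟨c, hc⟩ := exists_ball_subset_image_of_deriv_ne_zero hρ hld
    (norm_pos_iff.mp (lt_of_le_of_lt (by positivity) hlarge))
  obtain ⟨x, hx, hx1⟩ := exists_mem_ball_norm_exp_eq_one hK hcirc c
  rw [div_lt_iff₀ hρ] at hlarge
  obtain ⟨w, hw, rfl⟩ := hc (ball_subset_ball (by linarith) hx)
  have h1 := hesc (n + 1) w hw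
  rw [Function.iterate_succ_apply', ← hl w hw, hx1, Real.log_one, abs_zero] at h1
  linarith
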